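/- Let $G=(V,E)$ be a finite simple undirected graph with edge weights $w(e)\ge 0$ such that the edges of positive weight connect $V$ (for strictly positive weights, e.g. $w(e)=\exp(-\mu c(e))$ with real edge costs $c(e)$ and $\mu\ge 0$, this just says that $G$ is connected). The weight of a graph is the product of its edge weights, and the weight of a set of graphs is the sum of the weights of its members. Let $\mathcal T$ be the set of spanning trees of $G$; let $\mathcal F_u^v$ be the set of spanning forests of $G$ consisting of exactly two trees such that $u$ and $v$ lie in different trees; and let $\mathcal F_{u,q}^{v}=\mathcal F_u^v\cap\mathcal F_q^v$. For distinct seeds $s_1,s_2\in V$ and $q\in V$ let $$P(q\sim s_1)=\sum_{f\in\mathcal F_{s_1,q}^{s_2}}\frac{w(f)}{w(\mathcal F_{s_1}^{s_2})}$$ be the probability that a forest sampled from $\mathcal F_{s_1}^{s_2}$ with probability proportional to its weight connects $q$ with $s_1$, and define $P(q\sim s_2)$ in the same way with $s_1$ and $s_2$ exchanged. Let $L$ be the weighted Laplacian of $G$, and for $u,v\in V$ let $R(u,v)=(\nu_u-\nu_v)/I$ be the effective resistance, where $I\neq0$ and $\nu\in\mathbb R^V$ is a potential for a current $I$ from $u$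 to $v$, i.e. $L\nu=I(\mathbf 1_u-\mathbf 1_v)$. Then: 1. For all $u,v\in V$ the effective resistance is well defined: a potential exists for $I=1$, and $(\nu_u-\nu_v)/I$ is the same for all $I\ne0$ and all potentials $\nu$ for the current $I$ from $u$ to $v$. 2. $w(\mathcal T)>0$, and for all $u,v\in V$, $$R(u,v)=\frac{w(\mathcal F_u^v)}{w(\mathcal T)}.$$ 3. For all $s_1\ne s_2$ and $q$ in $V$ we have $w(\mathcal F_{s_1}^{s_2})>0$, $R(s_1,s_2)>0$, the triangle inequality $R(s_1,q)\le R(s_1,s_2)+R(s_2,q)$, and $$P(q\sim s_1)=\frac{R(s_2,q)+R(s_1,s_2)-R(s_1,q)}{2R(s_1,s_2)},$$ so that for fixed seeds $P(q\sim s_1)$ is proportional to the gap in this triangle inequality. 4. For all $s_1\ne s_2$ and $q$ in $V$, $$P(q\sim s_1)\ge P(q\sim s_2)\iff R(s_1,q)\le R(s_2,q).$$ -/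

import Mathlib

namespace ProbWatershed

variable {V : Type*}

/-- The spanning subgraph of `G` formed by its edges of positive weight. -/
def positivePart (G : SimpleGraph V) (w : Sym2 V → ℝ) : SimpleGraph V where
  Adj x y := G.Adj x y ∧ 0 < w s(x, y)
  symm := ⟨fun x y h => ⟨h.1.symm, by rw [Sym2.eq_swap]; exact h.2⟩⟩
  loopless := ⟨fun x h => G.loopless.irrefl x h.1⟩

/-- For strictly positive weights, such as `w e = exp (-μ * c e)`, the positive part is `G`. -/
theorem positivePart_eq (G : SimpleGraph V) (w : Sym2 V → ℝ) (hw : ∀ e ∈ G.edgeSet, 0 < w e) :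
    positivePart G w = G := by
  ext x y
  exact ⟨fun h => h.1, fun h => ⟨h, hw _ h⟩⟩

variable [Fintype V]

open Classical in
/-- The weight of a graph: the product of the weights of its edges. -/
noncomputable def graphWeight (w : Sym2 V → ℝ) (H : SimpleGraph V) : ℝ :=
  ∏ e ∈ H.edgeFinset, w e

open Classical in
/-- The weight of a set of graphs: the sum of the weights of its members. -/
noncomputable def setWeight (w : Sym2 V → ℝ) (S : Set (SimpleGraph V)) : ℝ :=
  ∑ H ∈ S.toFinset, graphWeight w H

/-- The spanning trees of `G`, as graphs on the whole vertex set. -/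
def spanningTrees (G : SimpleGraph V) : Set (SimpleGraph V) :=
  {t | t ≤ G ∧ t.IsTree}

/-- The spanning forests of `G` with exactly two trees, `u` and `v` lying in different trees. -/
def twoForests (G : SimpleGraph V) (u v : V) : Set (SimpleGraph V) :=
  {f | f ≤ G ∧ f.IsAcyclic ∧ Nat.card f.ConnectedComponent = 2 ∧ ¬ f.Reachable u v}

/-- The 2-forests of `G` having `u` and `q` in one tree and `v` in the other. -/
def twoForestsWith (G : SimpleGraph V) (u q v : V) : Set (SimpleGraph V) :=
  twoForests G u v ∩ twoForests G q v

/-- The Gibbs probability of the 2-forest `f` among those separating `s₁` and `s₂`. -/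
noncomputable def gibbsProb (G : SimpleGraph V) (w : Sym2 V → ℝ) (s₁ s₂ : V)
    (f : SimpleGraph V) : ℝ :=
  graphWeight w f / setWeight w (twoForests G s₁ s₂)

open Classical in
/-- `P(q ∼ s₁)`: the probability that a 2-forest sampled from the Gibbs distribution on the
2-forests separating `s₁` and `s₂` connects `q` to `s₁`. -/
noncomputable def connProb (G : SimpleGraph V) (w : Sym2 V → ℝ) (s₁ s₂ q : V) : ℝ :=
  ∑ f ∈ (twoForestsWith G s₁ q s₂).toFinset, gibbsProb G w s₁ s₂ f

open Classical in
/-- The weighted Laplacian; pairs that are not edges of `G` count with weight `0`. -/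
noncomputable def laplacian (G : SimpleGraph V) (w : Sym2 V → ℝ) : Matrix V V ℝ :=
  fun x y =>
    if x = y then ∑ k : V, (if G.Adj x k then w s(x, k) else 0)
    else if G.Adj x y then - w s(x, y) else 0

open Classical in
/-- `ν` is a potential for a current `I` entering the network at `u` and leaving it at `v`,
each edge `e` being a conductor of resistance `1 / w e`. By Ohm's and Kirchhoff's laws,
`L ν = I • (1_u - 1_v)`. -/
def IsPotential (G : SimpleGraph V) (w : Sym2 V → ℝ) (I : ℝ) (u v : V) (ν : V → ℝ) : Prop :=
  (laplacian G w).mulVec ν = I • (Pi.single u 1 - Pi.single v 1)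

/-- The effective resistance `(ν_u - ν_v) / I`, where `ν` is a potential for a nonzero current `I`
from `u` to `v`. -/
noncomputable def effRes (G : SimpleGraph V) (w : Sym2 V → ℝ) (u v : V) : ℝ :=
  Classical.epsilon fun r : ℝ =>
    ∃ (I : ℝ) (ν : V → ℝ), I ≠ 0 ∧ IsPotential G w I u v ν ∧ r = (ν u - ν v) / I

end ProbWatershed

/-! The forests themselves give a potential. Let `p x` be half the sum over 2-forests `f` of `w(f)`
times `1[u ~ x] - 1[v ~ x]`. Across an edge `x k` only forests separating `x` from `k` contribute to
the drop of `p`; adding `x k` turns them into the spanning trees through `x k`, with the factor `w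
s(x, k)` absorbed. So the net current out of `x` is a sum over trees, and each tree carries `w(t)`
units from `u` to `v`. Hence `L p = w(T) (1_u - 1_v)` (`laplacian_mulVec_forestPotential`), while `p
u - p v` is the weight of the forests separating `u` and `v`. Symmetry of `L` makes the resistance
independent of the potential. The probability formula is then an identity of indicators, checked on
each 2-forest (`two_mul_setWeight_twoForestsWith`). -/

namespace ProbWatershed

/-! ### Exchanging an edge between trees and 2-forests -/

section Graph

variable {V : Type*}

/-- In a graph with two components, a vertex lies in one of two distinct components. -/
theorem reachable_or_reachable_of_card_eq_two {f : SimpleGraph V}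
    (hc : Nat.card f.ConnectedComponent = 2) {x k : V} (hxk : ¬ f.Reachable x k) (y : V) :
    f.Reachable y x ∨ f.Reachable y k := by
  obtain ⟨c, -, hc'⟩ := (Nat.card_eq_two_iff' (f.connectedComponentMk x)).1 hc
  by_contra! h
  have h1 := hc' (f.connectedComponentMk y) fun e => h.1 (SimpleGraph.ConnectedComponent.exact e)
  have h2 := hc' (f.connectedComponentMk k) fun e =>
    hxk (SimpleGraph.ConnectedComponent.exact e).symm
  exact h.2 (SimpleGraph.ConnectedComponent.exact (h1.trans h2.symm))

/-- A walk towards `x` stays intact until it first uses the edge `x k`, and at that moment it stands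
at `x` or `k`. -/
theorem reachable_deleteEdges_or {t : SimpleGraph V} {x k y : V} (h : t.Reachable y x) :
    (t.deleteEdges {s(x, k)}).Reachable y x ∨ (t.deleteEdges {s(x, k)}).Reachable y k := by
  obtain ⟨p⟩ := h
  induction p with
  | nil => exact Or.inl .rfl
  | @cons a b c hab p ih =>
    by_cases he : s(a, b) = s(c, k)
    · rcases Sym2.eq_iff.1 he with ⟨rfl, -⟩ | ⟨rfl, -⟩
      · exact Or.inl .rfl
      · exact Or.inr .rfl
    · have : (t.deleteEdges {s(c, k)}).Reachable a b :=
        SimpleGraph.Adj.reachable (SimpleGraph.deleteEdges_adj.2 ⟨hab, he⟩)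
      exact ih.imp this.trans this.trans

theorem not_reachable_deleteEdges {t : SimpleGraph V} (ht : t.IsAcyclic) {x k : V}
    (hxk : t.Adj x k) : ¬ (t.deleteEdges {s(x, k)}).Reachable x k :=
  SimpleGraph.isBridge_iff.1 (SimpleGraph.isAcyclic_iff_forall_adj_isBridge.1 ht hxk)

/-- Removing an edge from a tree leaves two components. -/
theorem card_connectedComponent_deleteEdges {t : SimpleGraph V} (ht : t.IsTree) {x k : V}
    (hxk : t.Adj x k) : Nat.card (t.deleteEdges {s(x, k)}).ConnectedComponent = 2 := by
  have hn := not_reachable_deleteEdges ht.isAcyclic hxk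
  refine (Nat.card_eq_two_iff' ((t.deleteEdges {s(x, k)}).connectedComponentMk x)).2
    ⟨(t.deleteEdges {s(x, k)}).connectedComponentMk k,
      fun e => hn (SimpleGraph.ConnectedComponent.exact e).symm, fun c => ?_⟩
  induction c using SimpleGraph.ConnectedComponent.ind with
  | _ y =>
    intro hy
    rcases reachable_deleteEdges_or (k := k) (ht.connected.preconnected y x) with h | h
    · exact absurd (SimpleGraph.ConnectedComponent.sound h) hy
    · exact SimpleGraph.ConnectedComponent.sound h

/-- Joining the two trees of a 2-forest by an edge gives a tree. -/
theorem isTree_sup_edge {f : SimpleGraph V} (hf : f.IsAcyclic)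
    (hc : Nat.card f.ConnectedComponent = 2) {x k : V} (hxk : ¬ f.Reachable x k) :
    (f ⊔ SimpleGraph.edge x k).IsTree := by
  have hne : x ≠ k := fun h => hxk (h ▸ .rfl)
  have hr : ∀ y, (f ⊔ SimpleGraph.edge x k).Reachable y x := fun y => by
    rcases reachable_or_reachable_of_card_eq_two hc hxk y with h | h
    · exact h.mono le_sup_left
    · refine (h.mono le_sup_left).trans (SimpleGraph.Adj.reachable (Or.inr ?_))
      simp [SimpleGraph.edge_adj, hne, hne.symm]
  exact ⟨(SimpleGraph.connected_iff _).2 ⟨fun a b => (hr a).trans (hr b).symm, ⟨x⟩⟩,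
    hf.sup_edge_of_not_reachable hxk⟩

theorem sup_edge_deleteEdges {f : SimpleGraph V} {x k : V} (hxk : ¬ f.Adj x k) :
    (f ⊔ SimpleGraph.edge x k).deleteEdges {s(x, k)} = f := by
  ext a b
  by_cases he : s(a, b) = s(x, k)
  · have : ¬ f.Adj a b := by
      rwa [← SimpleGraph.mem_edgeSet, he, SimpleGraph.mem_edgeSet]
    simp [SimpleGraph.deleteEdges_adj, he, this]
  · simp only [SimpleGraph.deleteEdges_adj, SimpleGraph.sup_adj, SimpleGraph.edge_adj,
      Set.mem_singleton_iff, he, not_false_eq_true, and_true]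
    rw [Sym2.eq_iff] at he
    tauto

theorem deleteEdges_sup_edge {t : SimpleGraph V} {x k : V} (hxk : t.Adj x k) :
    t.deleteEdges {s(x, k)} ⊔ SimpleGraph.edge x k = t := by
  ext a b
  by_cases he : s(a, b) = s(x, k)
  · have h1 : t.Adj a b := by
      rwa [← SimpleGraph.mem_edgeSet, he, SimpleGraph.mem_edgeSet]
    have h2 : (SimpleGraph.edge x k).Adj a b := by
      rw [SimpleGraph.edge_adj]
      exact ⟨by rw [Sym2.eq_iff] at he; tauto, h1.ne⟩
    simp [h1, h2]
  · simp only [SimpleGraph.deleteEdges_adj, SimpleGraph.sup_adj, SimpleGraph.edge_adj,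
      Set.mem_singleton_iff, he, not_false_eq_true, and_true]
    rw [Sym2.eq_iff] at he
    tauto

/-- In a tree, exactly one edge at `x` separates `x` from a given other vertex. -/
theorem existsUnique_adj_not_reachable_deleteEdges {t : SimpleGraph V} (ht : t.IsTree) {u x : V}
    (hux : u ≠ x) : ∃! k, t.Adj x k ∧ ¬ (t.deleteEdges {s(x, k)}).Reachable u x := by
  obtain ⟨p, hp, -⟩ := ht.existsUnique_path x u
  cases p with
  | nil => exact absurd rfl hux
  | @cons _ b _ hxb p =>
    rw [SimpleGraph.Walk.cons_isPath_iff] at hp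
    -- The rest of the path never returns to `x`, so it survives the deletion of any edge at `x`;
    -- only its first edge can separate.
    have hp' : ∀ k, s(x, k) ∉ p.edges := fun k h => hp.2 (p.fst_mem_support_of_mem_edges h)
    have hr : ∀ k, (t.deleteEdges {s(x, k)}).Reachable b u := fun k =>
      ⟨p.toDeleteEdge s(x, k) (hp' k)⟩
    refine ⟨b, ⟨hxb, fun h => ?_⟩, fun k hk => ?_⟩
    · exact not_reachable_deleteEdges ht.isAcyclic hxb ((hr b).trans h).symm
    · by_contra hkb
      refine hk.2 ((hr k).symm.trans (SimpleGraph.Adj.reachable ?_))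
      rw [SimpleGraph.deleteEdges_adj]
      refine ⟨hxb.symm, fun h => hkb ?_⟩
      rcases Sym2.eq_iff.1 (Set.mem_singleton_iff.1 h) with ⟨h1, h2⟩ | ⟨h1, -⟩
      · exact absurd h1 hxb.ne'
      · exact h1.symm

theorem positivePart_le (G : SimpleGraph V) (w : Sym2 V → ℝ) : positivePart G w ≤ G :=
  fun _ _ h => h.1

end Graph

/-! ### Weights and their positivity -/

section Weights

open Classical

variable {V : Type*} [Fintype V]

theorem setWeight_eq_sum (w : Sym2 V → ℝ) (S : Set (SimpleGraph V)) :
    setWeight w S = ∑ H : SimpleGraph V, if H ∈ S then graphWeight w H else 0 := by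
  rw [setWeight, ← Finset.sum_filter]
  exact Finset.sum_congr (by ext; simp) fun _ _ => rfl

theorem graphWeight_nonneg {G : SimpleGraph V} {w : Sym2 V → ℝ} (hw : ∀ e ∈ G.edgeSet, 0 ≤ w e)
    {H : SimpleGraph V} (hH : H ≤ G) : 0 ≤ graphWeight w H :=
  Finset.prod_nonneg fun e he =>
    hw e (SimpleGraph.edgeSet_subset_edgeSet.2 hH (SimpleGraph.mem_edgeFinset.1 he))

theorem graphWeight_pos {G : SimpleGraph V} {w : Sym2 V → ℝ} {H : SimpleGraph V}
    (hH : H ≤ positivePart G w) : 0 < graphWeight w H :=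
  Finset.prod_pos fun e he => by
    have h := SimpleGraph.edgeSet_subset_edgeSet.2 hH (SimpleGraph.mem_edgeFinset.1 he)
    induction e using Sym2.ind with
    | _ x y => exact h.2

/-- Weights may vanish, so one member must use only edges of positive weight. -/
theorem setWeight_pos {G : SimpleGraph V} {w : Sym2 V → ℝ} (hw : ∀ e ∈ G.edgeSet, 0 ≤ w e)
    {S : Set (SimpleGraph V)} (hS : ∀ H ∈ S, H ≤ G) {H : SimpleGraph V} (hHS : H ∈ S)
    (hH : H ≤ positivePart G w) : 0 < setWeight w S :=
  Finset.sum_pos' (fun f hf => graphWeight_nonneg hw (hS f (Set.mem_toFinset.1 hf)))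
    ⟨H, Set.mem_toFinset.2 hHS, graphWeight_pos hH⟩

theorem setWeight_nonneg {G : SimpleGraph V} {w : Sym2 V → ℝ} (hw : ∀ e ∈ G.edgeSet, 0 ≤ w e)
    {S : Set (SimpleGraph V)} (hS : ∀ H ∈ S, H ≤ G) : 0 ≤ setWeight w S :=
  Finset.sum_nonneg fun f hf => graphWeight_nonneg hw (hS f (Set.mem_toFinset.1 hf))

theorem setWeight_spanningTrees_pos {G : SimpleGraph V} {w : Sym2 V → ℝ}
    (hw : ∀ e ∈ G.edgeSet, 0 ≤ w e) (hconn : (positivePart G w).Connected) :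
    0 < setWeight w (spanningTrees G) := by
  obtain ⟨t, ht, htree⟩ := hconn.exists_isTree_le
  exact setWeight_pos hw (fun H hH => hH.1) ⟨ht.trans (positivePart_le G w), htree⟩ ht

/-- The witness is a spanning tree of the positive part, cut at the edge at `v` that leads towards
`u`. -/
theorem setWeight_twoForests_pos {G : SimpleGraph V} {w : Sym2 V → ℝ}
    (hw : ∀ e ∈ G.edgeSet, 0 ≤ w e) (hconn : (positivePart G w).Connected) {u v : V}
    (huv : u ≠ v) : 0 < setWeight w (twoForests G u v) := by
  obtain ⟨t, ht, htree⟩ := hconn.exists_isTree_le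
  obtain ⟨k, ⟨hk, hsep⟩, -⟩ := existsUnique_adj_not_reachable_deleteEdges htree huv
  have hle := t.deleteEdges_le {s(v, k)}
  exact setWeight_pos hw (fun H hH => hH.1)
    ⟨(hle.trans ht).trans (positivePart_le G w), htree.isAcyclic.anti hle,
      card_connectedComponent_deleteEdges htree hk, hsep⟩ (hle.trans ht)

theorem graphWeight_deleteEdges (w : Sym2 V → ℝ) {t : SimpleGraph V} {x k : V}
    (hxk : t.Adj x k) : w s(x, k) * graphWeight w (t.deleteEdges {s(x, k)}) = graphWeight w t := by
  have : graphWeight w (t.deleteEdges {s(x, k)}) = ∏ e ∈ t.edgeFinset.erase s(x, k), w e :=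
    Finset.prod_congr (by ext e; simp [SimpleGraph.edgeSet_deleteEdges, and_comm]) fun _ _ => rfl
  rw [this]
  exact Finset.mul_prod_erase _ _ (SimpleGraph.mem_edgeFinset.2 hxk)

/-! ### Signs of the two sides of a forest -/

/-- The spanning forests of `G` with exactly two trees. -/
def twoTreeForests (G : SimpleGraph V) : Set (SimpleGraph V) :=
  {f | f ≤ G ∧ f.IsAcyclic ∧ Nat.card f.ConnectedComponent = 2}

/-- The indicator that `x` lies in the component of `u`, minus the one for `v`. -/
noncomputable def sideSign (f : SimpleGraph V) (u v x : V) : ℝ :=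
  (if f.Reachable u x then 1 else 0) - (if f.Reachable v x then 1 else 0)

/-- If `x` and `k` are separated, each of `u`, `v` lies on exactly one of their sides, so passing
from `x` to `k` flips the sign. -/
theorem sideSign_sub_sideSign {f : SimpleGraph V} (hc : Nat.card f.ConnectedComponent = 2)
    (u v x k : V) : sideSign f u v x - sideSign f u v k =
      if f.Reachable x k then 0 else 2 * sideSign f u v x := by
  by_cases hxk : f.Reachable x k
  · have h : ∀ a, f.Reachable a x ↔ f.Reachable a k := fun a =>
      ⟨fun h => h.trans hxk, fun h => h.trans hxk.symm⟩
    simp [sideSign, hxk, h]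
  · have h : ∀ a, f.Reachable a k ↔ ¬ f.Reachable a x := fun a =>
      ⟨fun h h' => hxk (h'.symm.trans h),
        (reachable_or_reachable_of_card_eq_two hc hxk a).resolve_left⟩
    rw [if_neg hxk]
    simp only [sideSign, h]
    split_ifs <;> norm_num

/-- This is Kirchhoff's law for the unit flow from `u` to `v` inside a single tree. -/
theorem sum_sideSign_deleteEdges {t : SimpleGraph V} (ht : t.IsTree) (u v x : V) :
    ∑ k : V, (if t.Adj x k then sideSign (t.deleteEdges {s(x, k)}) u v x else 0) =
      (Pi.single u 1 - Pi.single v 1 : V → ℝ) x := by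
  -- Of the tree edges at `x`, all but one keep `a` on the side of `x`, and all do if `a = x`. The
  -- degree of `x` cancels between `u` and `v`.
  have key : ∀ a : V, ∑ k : V, (if t.Adj x k then
      (if (t.deleteEdges {s(x, k)}).Reachable a x then (1 : ℝ) else 0) else 0) =
      (∑ k : V, if t.Adj x k then (1 : ℝ) else 0) - 1 + (Pi.single a 1 : V → ℝ) x := by
    intro a
    by_cases hax : a = x
    · subst hax
      simp
    · obtain ⟨b, ⟨hb, hb'⟩, huniq⟩ := existsUnique_adj_not_reachable_deleteEdges ht hax
      have : ∀ k, (if t.Adj x k then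
          (if (t.deleteEdges {s(x, k)}).Reachable a x then (1 : ℝ) else 0) else 0) =
          (if t.Adj x k then (1 : ℝ) else 0) - if k = b then 1 else 0 := by
        intro k
        by_cases hk : k = b
        · subst hk
          simp [hb, hb']
        · by_cases hadj : t.Adj x k
          · have : (t.deleteEdges {s(x, k)}).Reachable a x := by
              by_contra h
              exact hk (huniq k ⟨hadj, h⟩)
            simp [hadj, this, hk]
          · simp [hadj, hk]
      simp [this, Finset.sum_sub_distrib, Ne.symm hax]
  have hsplit : ∀ k, (if t.Adj x k then sideSign (t.deleteEdges {s(x, k)}) u v x else 0) =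
      (if t.Adj x k then
        (if (t.deleteEdges {s(x, k)}).Reachable u x then (1 : ℝ) else 0) else 0) -
      (if t.Adj x k then
        (if (t.deleteEdges {s(x, k)}).Reachable v x then (1 : ℝ) else 0) else 0) := by
    intro k
    by_cases h : t.Adj x k
    · simp only [h, if_true, sideSign]
      congr
    · simp [h]
  rw [Finset.sum_congr rfl fun k _ => hsplit k, Finset.sum_sub_distrib, key u, key v, Pi.sub_apply]
  ring

/-- Adding the edge `x k` is a weight-preserving bijection from the 2-forests separating `x` and
`k` onto the spanning trees containing this edge. -/
theorem sum_twoTreeForests_eq_sum_spanningTrees (G : SimpleGraph V) (w : Sym2 V → ℝ)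
    (φ : SimpleGraph V → ℝ) {x k : V} (hG : G.Adj x k) :
    ∑ f : SimpleGraph V, (if f ∈ twoTreeForests G ∧ ¬ f.Reachable x k then
        w s(x, k) * graphWeight w f * φ f else 0) =
      ∑ t : SimpleGraph V, (if t ∈ spanningTrees G ∧ t.Adj x k then
        graphWeight w t * φ (t.deleteEdges {s(x, k)}) else 0) := by
  have hnadj : ∀ {f : SimpleGraph V}, ¬ f.Reachable x k → ¬ f.Adj x k :=
    fun h h' => h h'.reachable
  have hadj : ∀ f : SimpleGraph V, (f ⊔ SimpleGraph.edge x k).Adj x k := fun f =>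
    Or.inr (by simp [SimpleGraph.edge_adj, hG.ne])
  rw [← Finset.sum_filter, ← Finset.sum_filter]
  refine Finset.sum_bij' (fun f _ => f ⊔ SimpleGraph.edge x k)
    (fun t _ => t.deleteEdges {s(x, k)}) ?_ ?_ ?_ ?_ ?_
  · intro f hf
    obtain ⟨⟨hle, hac, hc⟩, hr⟩ := (Finset.mem_filter.1 hf).2
    refine Finset.mem_filter.2 ⟨Finset.mem_univ _, ⟨sup_le hle ?_, isTree_sup_edge hac hc hr⟩,
      hadj f⟩
    exact (SimpleGraph.edge_le_iff G).2 (Or.inr hG)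
  · intro t ht
    obtain ⟨⟨hle, htree⟩, hk⟩ := (Finset.mem_filter.1 ht).2
    have hd := t.deleteEdges_le {s(x, k)}
    exact Finset.mem_filter.2 ⟨Finset.mem_univ _, ⟨hd.trans hle, htree.isAcyclic.anti hd,
      card_connectedComponent_deleteEdges htree hk⟩, not_reachable_deleteEdges htree.isAcyclic hk⟩
  · intro f hf
    exact sup_edge_deleteEdges (hnadj (Finset.mem_filter.1 hf).2.2)
  · intro t ht
    exact deleteEdges_sup_edge (Finset.mem_filter.1 ht).2.2
  · intro f hf
    have hd := sup_edge_deleteEdges (hnadj (Finset.mem_filter.1 hf).2.2)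
    rw [← graphWeight_deleteEdges w (hadj f), hd]

/-! ### The Laplacian and the forest potential -/

theorem laplacian_mulVec (G : SimpleGraph V) (w : Sym2 V → ℝ) (ν : V → ℝ) (x : V) :
    (laplacian G w).mulVec ν x = ∑ k : V, if G.Adj x k then w s(x, k) * (ν x - ν k) else 0 := by
  have : ∀ k, laplacian G w x k * ν k =
      (if x = k then (∑ k : V, (if G.Adj x k then w s(x, k) else 0)) * ν x else 0) -
        if G.Adj x k then w s(x, k) * ν k else 0 := by
    intro k
    by_cases hk : x = k
    · subst hk
      simp [laplacian]
    · by_cases h : G.Adj x k <;> simp [laplacian, hk, h]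
  simp only [Matrix.mulVec, dotProduct, this, Finset.sum_sub_distrib, Finset.sum_ite_eq,
    Finset.mem_univ, if_true, Finset.sum_mul]
  rw [← Finset.sum_sub_distrib]
  refine Finset.sum_congr rfl fun k _ => ?_
  split_ifs <;> ring

theorem laplacian_isSymm (G : SimpleGraph V) (w : Sym2 V → ℝ) : (laplacian G w).IsSymm := by
  ext x y
  by_cases h : x = y
  · subst h
    rfl
  · simp [Matrix.transpose_apply, laplacian, h, Ne.symm h, G.adj_comm y x, Sym2.eq_swap (a := y)]

/-- The weight of the 2-forests joining `x` to `u`, up to an additive constant. -/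
noncomputable def forestPotential (G : SimpleGraph V) (w : Sym2 V → ℝ) (u v x : V) : ℝ :=
  (∑ f : SimpleGraph V,
    if f ∈ twoTreeForests G then graphWeight w f * sideSign f u v x else 0) / 2

/-- The halving in `forestPotential` cancels the factor 2 from the sign flip. -/
theorem forestPotential_sub (G : SimpleGraph V) (w : Sym2 V → ℝ) (u v x k : V) :
    forestPotential G w u v x - forestPotential G w u v k =
      ∑ f : SimpleGraph V, if f ∈ twoTreeForests G ∧ ¬ f.Reachable x k then
        graphWeight w f * sideSign f u v x else 0 := by
  rw [forestPotential, forestPotential, ← sub_div, ← Finset.sum_sub_distrib, Finset.sum_div]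
  refine Finset.sum_congr rfl fun f _ => ?_
  by_cases hf : f ∈ twoTreeForests G
  · have h := sideSign_sub_sideSign hf.2.2 u v x k
    simp only [hf, if_true, true_and, ← mul_sub, h]
    split_ifs <;> ring
  · simp [hf]

theorem forestPotential_sub_self (G : SimpleGraph V) (w : Sym2 V → ℝ) (u v : V) :
    forestPotential G w u v u - forestPotential G w u v v = setWeight w (twoForests G u v) := by
  rw [forestPotential_sub, setWeight_eq_sum]
  refine Finset.sum_congr rfl fun f _ => ?_
  have : f ∈ twoForests G u v ↔ f ∈ twoTreeForests G ∧ ¬ f.Reachable u v := by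
    simp [twoForests, twoTreeForests, and_assoc]
  rw [this]
  split_ifs with h
  · simp [sideSign, SimpleGraph.reachable_comm (u := v), h.2]
  · rfl

/-- Double counting: pairs of an edge at `x` and a forest it joins become pairs of a spanning tree
and one of its edges at `x`. -/
theorem laplacian_mulVec_forestPotential (G : SimpleGraph V) (w : Sym2 V → ℝ) (u v : V) :
    (laplacian G w).mulVec (forestPotential G w u v) =
      setWeight w (spanningTrees G) • (Pi.single u 1 - Pi.single v 1) := by
  ext x
  have hedge : ∀ k : V, (if G.Adj x k then
      w s(x, k) * (forestPotential G w u v x - forestPotential G w u v k) else 0) =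
      ∑ t : SimpleGraph V, if t ∈ spanningTrees G then graphWeight w t *
        (if t.Adj x k then sideSign (t.deleteEdges {s(x, k)}) u v x else 0) else 0 := by
    intro k
    by_cases hG : G.Adj x k
    · have h := sum_twoTreeForests_eq_sum_spanningTrees G w (fun f => sideSign f u v x) hG
      rw [if_pos hG, forestPotential_sub, Finset.mul_sum]
      refine Eq.trans (Finset.sum_congr rfl fun f _ => ?_) (h.trans
        (Finset.sum_congr rfl fun t _ => ?_))
      · split_ifs <;> ring
      · by_cases h1 : t ∈ spanningTrees G <;> by_cases h2 : t.Adj x k <;> simp [h1, h2]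
    · rw [if_neg hG]
      refine (Finset.sum_eq_zero fun t _ => ?_).symm
      split_ifs with h1 h2
      · exact absurd (h1.1 h2) hG
      · ring
      · rfl
  rw [laplacian_mulVec, Finset.sum_congr rfl fun k _ => hedge k, Finset.sum_comm,
    setWeight_eq_sum, Pi.smul_apply, smul_eq_mul, Finset.sum_mul]
  refine Finset.sum_congr rfl fun t _ => ?_
  by_cases ht : t ∈ spanningTrees G
  · simp only [ht, if_true]
    rw [← Finset.mul_sum, sum_sideSign_deleteEdges ht.2]
  · simp [ht]

/-! ### Effective resistance -/

theorem isPotential_forestPotential {G : SimpleGraph V} {w : Sym2 V → ℝ}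
    (hT : setWeight w (spanningTrees G) ≠ 0) (u v : V) :
    IsPotential G w 1 u v ((setWeight w (spanningTrees G))⁻¹ • forestPotential G w u v) := by
  rw [IsPotential, Matrix.mulVec_smul, laplacian_mulVec_forestPotential, smul_smul,
    inv_mul_cancel₀ hT]

/-- Reciprocity: potentials for the same terminals have proportional differences. -/
theorem IsPotential.mul_sub_eq {G : SimpleGraph V} {w : Sym2 V → ℝ} {I J : ℝ} {u v : V}
    {ν μ : V → ℝ} (hν : IsPotential G w I u v ν) (hμ : IsPotential G w J u v μ) :
    J * (ν u - ν v) = I * (μ u - μ v) := by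
  -- Pairing each potential with the other's current avoids any knowledge of the kernel of `L`.
  have h : ν ⬝ᵥ (laplacian G w).mulVec μ = μ ⬝ᵥ (laplacian G w).mulVec ν := by
    rw [Matrix.dotProduct_mulVec, ← Matrix.mulVec_transpose, (laplacian_isSymm G w).eq,
      dotProduct_comm]
  rw [IsPotential] at hν hμ
  rw [hν, hμ] at h
  simpa [dotProduct_smul, dotProduct_sub] using h

/-- The choice operator returns the value of some unknown current and potential; reciprocity equates
it with the given one. -/
theorem effRes_eq {G : SimpleGraph V} {w : Sym2 V → ℝ} {I : ℝ} {u v : V} {ν : V → ℝ}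
    (hI : I ≠ 0) (hν : IsPotential G w I u v ν) : effRes G w u v = (ν u - ν v) / I := by
  obtain ⟨J, μ, hJ, hμ, h⟩ := Classical.epsilon_spec
    (p := fun r : ℝ => ∃ (I : ℝ) (ν : V → ℝ), I ≠ 0 ∧ IsPotential G w I u v ν ∧
      r = (ν u - ν v) / I) ⟨_, I, ν, hI, hν, rfl⟩
  rw [effRes, h, div_eq_div_iff hJ hI]
  linarith [hν.mul_sub_eq hμ]

theorem effRes_eq_div {G : SimpleGraph V} {w : Sym2 V → ℝ}
    (hT : setWeight w (spanningTrees G) ≠ 0) (u v : V) : effRes G w u v =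
      setWeight w (twoForests G u v) / setWeight w (spanningTrees G) := by
  rw [effRes_eq one_ne_zero (isPotential_forestPotential hT u v), ← forestPotential_sub_self]
  simp only [Pi.smul_apply, smul_eq_mul]
  ring

/-! ### Probabilities and the triangle inequality -/

theorem twoForests_comm (G : SimpleGraph V) (u v : V) : twoForests G u v = twoForests G v u := by
  simp [twoForests, SimpleGraph.reachable_comm (u := u)]

/-- Of three vertices two lie in the same tree of a 2-forest. -/
theorem two_mul_setWeight_twoForestsWith (G : SimpleGraph V) (w : Sym2 V → ℝ) (s₁ s₂ q : V) :
    2 * setWeight w (twoForestsWith G s₁ q s₂) = setWeight w (twoForests G s₂ q) +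
      setWeight w (twoForests G s₁ s₂) - setWeight w (twoForests G s₁ q) := by
  simp only [setWeight_eq_sum, Finset.mul_sum]
  rw [← Finset.sum_add_distrib, ← Finset.sum_sub_distrib]
  refine Finset.sum_congr rfl fun f _ => ?_
  have hmem : ∀ u v, f ∈ twoForests G u v ↔ f ∈ twoTreeForests G ∧ ¬ f.Reachable u v := by
    simp [twoForests, twoTreeForests, and_assoc]
  rw [twoForestsWith, Set.mem_inter_iff]
  simp only [hmem]
  by_cases hf : f ∈ twoTreeForests G
  · simp only [hf, true_and]
    -- The indicator identity reads `0 = 0` or `0 = 1 - 1` when the seeds are joined, `2 = 1 + 1 -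
    -- 0` when `q` joins `s₁` only, and `0 = 0 + 1 - 1` when `q` joins `s₂` only.
    by_cases h12 : f.Reachable s₁ s₂
    · have : f.Reachable s₂ q ↔ f.Reachable s₁ q := ⟨h12.trans, h12.symm.trans⟩
      simp [h12, this]
    · rcases reachable_or_reachable_of_card_eq_two hf.2.2 h12 q with h | h
      · have h2 : ¬ f.Reachable q s₂ := fun h' => h12 (h.symm.trans h')
        simp [h12, h2, h.symm, SimpleGraph.reachable_comm (u := s₂)]
        ring
      · have h1 : ¬ f.Reachable s₁ q := fun h' => h12 (h'.trans h)
        simp [h12, h, h1, h.symm]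
  · simp [hf]

theorem connProb_eq_div (G : SimpleGraph V) (w : Sym2 V → ℝ) (s₁ s₂ q : V) :
    connProb G w s₁ s₂ q =
      setWeight w (twoForestsWith G s₁ q s₂) / setWeight w (twoForests G s₁ s₂) := by
  simp only [connProb, gibbsProb, setWeight, Finset.sum_div]

theorem effRes_comm {G : SimpleGraph V} {w : Sym2 V → ℝ}
    (hT : setWeight w (spanningTrees G) ≠ 0) (u v : V) : effRes G w u v = effRes G w v u := by
  rw [effRes_eq_div hT, effRes_eq_div hT, twoForests_comm]

/-- The probability of joining a seed is the normalized gap in the triangle inequality. -/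
theorem connProb_eq {G : SimpleGraph V} {w : Sym2 V → ℝ}
    (hT : setWeight w (spanningTrees G) ≠ 0) (s₁ s₂ q : V) :
    connProb G w s₁ s₂ q =
      (effRes G w s₂ q + effRes G w s₁ s₂ - effRes G w s₁ q) / (2 * effRes G w s₁ s₂) := by
  simp only [effRes_eq_div hT, connProb_eq_div]
  rw [← add_div, ← sub_div, ← two_mul_setWeight_twoForestsWith, ← mul_div_assoc,
    div_div_div_cancel_right₀ hT, mul_div_mul_left _ _ two_ne_zero]

/-- The gap is twice a forest weight over the tree weight, hence nonnegative. -/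
theorem effRes_triangle {G : SimpleGraph V} {w : Sym2 V → ℝ} (hw : ∀ e ∈ G.edgeSet, 0 ≤ w e)
    (hT : 0 < setWeight w (spanningTrees G)) (s₁ s₂ q : V) :
    effRes G w s₁ q ≤ effRes G w s₁ s₂ + effRes G w s₂ q := by
  simp only [effRes_eq_div hT.ne']
  rw [← add_div]
  refine div_le_div_of_nonneg_right ?_ hT.le
  have h : 0 ≤ setWeight w (twoForestsWith G s₁ q s₂) :=
    setWeight_nonneg hw fun H hH => hH.1.1
  linarith [two_mul_setWeight_twoForestsWith G w s₁ s₂ q]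

end Weights

end ProbWatershed

open ProbWatershed in
theorem mainTheorem4 {V : Type*} [Fintype V] (G : SimpleGraph V) (w : Sym2 V → ℝ)
    (hw : ∀ e ∈ G.edgeSet, 0 ≤ w e) (hconn : (positivePart G w).Connected) :
    -- the effective resistance is well defined
    (∀ u v : V, (∃ ν : V → ℝ, IsPotential G w 1 u v ν) ∧
      ∀ (I : ℝ) (ν : V → ℝ), I ≠ 0 → IsPotential G w I u v ν →
        effRes G w u v = (ν u - ν v) / I) ∧
    -- it is the ratio of the weights of the 2-forests and of the spanning trees
    0 < setWeight w (spanningTrees G) ∧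
    (∀ u v : V,
      effRes G w u v = setWeight w (twoForests G u v) / setWeight w (spanningTrees G)) ∧
    -- the probability is the normalized gap in the triangle inequality
    (∀ s₁ s₂ q : V, s₁ ≠ s₂ →
      0 < setWeight w (twoForests G s₁ s₂) ∧
      0 < effRes G w s₁ s₂ ∧
      effRes G w s₁ q ≤ effRes G w s₁ s₂ + effRes G w s₂ q ∧
      connProb G w s₁ s₂ q =
        (effRes G w s₂ q + effRes G w s₁ s₂ - effRes G w s₁ q) / (2 * effRes G w s₁ s₂) ∧
      (connProb G w s₁ s₂ q ≥ connProb G w s₂ s₁ q ↔ effRes G w s₁ q ≤ effRes G w s₂ q)) := by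
  have hT := setWeight_spanningTrees_pos hw hconn
  refine ⟨fun u v => ⟨⟨_, isPotential_forestPotential hT.ne' u v⟩, fun I ν => effRes_eq⟩, hT,
    effRes_eq_div hT.ne', fun s₁ s₂ q hs => ?_⟩
  have hF := setWeight_twoForests_pos hw hconn hs
  have hR : 0 < effRes G w s₁ s₂ := by
    rw [effRes_eq_div hT.ne']
    exact div_pos hF hT
  refine ⟨hF, hR, effRes_triangle hw hT s₁ s₂ q, connProb_eq hT.ne' s₁ s₂ q, ?_⟩
  -- By symmetry of the resistance both probabilities have the same positive denominator, so only
  -- numerators are compared.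
  rw [connProb_eq hT.ne' s₁ s₂ q, connProb_eq hT.ne' s₂ s₁ q, effRes_comm hT.ne' s₂ s₁, ge_iff_le,
    div_le_div_iff_of_pos_right (by positivity)]
  constructor <;> intro h <;> linarith
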